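/- Assume that the continuum hypothesis fails, i.e. $2^{\omega}\neq\omega_1$. Let $\gamma$ be an ordinal and let $X$ be an uncountable set of ordinals contained in $[0,\gamma]=\{\xi:\xi\le\gamma\}$, with the subspace topology inherited from the order topology of $[0,\gamma]$. Let $C_s(X)$ be the set of all continuous functions $X\to\mathbb R$ with the topology of uniform convergence on countable subsets of $X$ (equivalently, on separable subsets of $X$); that is, the sets $V(f,A,\varepsilon)=\{g\in C(X): |f(x)-g(x)|<\varepsilon \text{ for all } x\in A\}$, with $A\subseteq X$ countable and $\varepsilon>0$, form a system of neighborhoods of $f$. For a topological space $Y$, let the cellularity $c(Y)$ be the least infinite cardinal $\kappa$ such that every family of pairwise disjoint nonempty open subsets of $Y$ has cardinality at most $\kappa$. Then $X$ is pseudocompact (every continuous function $X\to\mathbb R$ is bounded) if and only if $$c(C_s(X))=\omega_1 .$$ -/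

import Mathlib

universe u

/-- `Y` is pseudocompact: every continuous real-valued function on `Y` is bounded. -/
def Pseudocompact (Y : Type*) [TopologicalSpace Y] : Prop :=
  ∀ f : C(Y, ℝ), ∃ M : ℝ, ∀ y : Y, |f y| ≤ M

/-- A cellular family in `Y`: a family of pairwise disjoint nonempty open sets. -/
def IsCellularFamily {Y : Type*} [TopologicalSpace Y] (𝒰 : Set (Set Y)) : Prop :=
  (∀ U ∈ 𝒰, IsOpen U ∧ U.Nonempty) ∧ 𝒰.Pairwise Disjoint

/-- The cellularity `c(Y)`: the least infinite cardinal `κ` such that every cellular family in `Y`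
has cardinality at most `κ`. -/
noncomputable def cellularity (Y : Type*) [TopologicalSpace Y] : Cardinal :=
  sInf {κ | Cardinal.aleph0 ≤ κ ∧ ∀ 𝒰 : Set (Set Y), IsCellularFamily 𝒰 → Cardinal.mk 𝒰 ≤ κ}

/-- `C_s(Y)`: the set of all continuous real-valued functions on `Y`, as a type of its own so that
it does not carry the compact-open topology. -/
def Cs (Y : Type*) [TopologicalSpace Y] : Type _ := C(Y, ℝ)

/-- The topology of `C_s(Y)` is that of uniform convergence on the countable subsets of `Y`, which
is the same as uniform convergence on the separable subsets of `Y`. -/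
instance Cs.instTopologicalSpace (Y : Type*) [TopologicalSpace Y] : TopologicalSpace (Cs Y) :=
  TopologicalSpace.induced
    (fun f : C(Y, ℝ) => UniformOnFun.ofFun {A : Set Y | A.Countable} (f : Y → ℝ)) inferInstance

open Set Filter Topology Cardinal Ordinal

/-! If X is not pseudocompact, an unbounded function yields a separated sequence whose subsets are
told apart by continuous functions, so the cellularity is at least `𝔠`, which exceeds `ℵ₁` when CH
fails (`continuum_le_cellularity_Cs`). Uncountability of X alone gives `ℵ₁` from below
(`aleph_one_le_cellularity_Cs`). If X is pseudocompact, each continuous function is uniformly near a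
step function with finitely many rational values (`Pseudocompact.exists_stepFun`). Among more than
`ℵ₁` basic open sets, a reflection argument finds two of equal radius whose step functions agree on
the common part of their countable closed supports (`exists_ne_stepFun_eq`). Urysohn gluing
(`exists_approx_of_closed`) then produces a common element. -/

/-- The functions that are `ε`-close to `f` on `A`. -/
def Cs.near {Y : Type*} [TopologicalSpace Y] (f : C(Y, ℝ)) (A : Set Y) (ε : ℝ) : Set (Cs Y) :=
  {g : C(Y, ℝ) | ∀ x ∈ A, |g x - f x| < ε}

theorem Cs.hasBasis_nhds {Y : Type*} [TopologicalSpace Y] (f : C(Y, ℝ)) :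
    (@nhds (Cs Y) _ f).HasBasis (fun p : Set Y × ℝ => p.1.Countable ∧ 0 < p.2)
      (fun p => Cs.near f p.1 p.2) := by
  have h := (UniformOnFun.hasBasis_nhds_of_basis Y ℝ {A : Set Y | A.Countable}
    (UniformOnFun.ofFun {A : Set Y | A.Countable} (f : Y → ℝ)) ⟨∅, countable_empty⟩
    (fun A hA B hB => ⟨A ∪ B, hA.union hB, subset_union_left, subset_union_right⟩)
    Metric.uniformity_basis_dist).comap
    (fun f : C(Y, ℝ) => UniformOnFun.ofFun {A : Set Y | A.Countable} (f : Y → ℝ))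
  have e : @nhds (Cs Y) _ f = _ := nhds_induced _ _
  rw [e]
  exact h

/-! ### Lower bounds from separated families -/

theorem le_cellularity {Y : Type u} [TopologicalSpace Y] {𝒰 : Set (Set Y)}
    (h : IsCellularFamily 𝒰) : #𝒰 ≤ cellularity Y := by
  refine le_csInf ⟨max ℵ₀ #(Set Y), le_max_left _ _, fun 𝒱 _ => ?_⟩ fun κ hκ => hκ.2 _ h
  exact (mk_set_le 𝒱).trans (le_max_right _ _)

theorem mk_le_cellularity_Cs {Y ι : Type u} [TopologicalSpace Y] (f : ι → C(Y, ℝ))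
    (A : ι → Set Y) (hA : ∀ i, (A i).Countable)
    (hf : ∀ i j, i ≠ j → ∃ x ∈ A i ∩ A j, 1 ≤ |f i x - f j x|) : #ι ≤ cellularity (Cs Y) := by
  let V : ι → Set (Cs Y) := fun i => interior (Cs.near (f i) (A i) (1 / 2))
  have hmem : ∀ i, f i ∈ V i := fun i =>
    (mem_interior_iff_mem_nhds (X := Cs Y)).2 <|
      (Cs.hasBasis_nhds (f i)).mem_of_mem (i := (A i, 1 / 2)) ⟨hA i, by norm_num⟩
  have hdisj : ∀ i j, i ≠ j → Disjoint (V i) (V j) := by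
    intro i j hij
    obtain ⟨x, hx, h1⟩ := hf i j hij
    refine Set.disjoint_left.2 fun g hi hj => ?_
    have h2 := abs_lt.1 (interior_subset hi x hx.1)
    have h3 := abs_lt.1 (interior_subset hj x hx.2)
    rcases le_abs.1 h1 with h | h <;> linarith
  have hinj : Function.Injective V := by
    intro i j hij
    by_contra hne
    have := hdisj i j hne
    rw [← hij, disjoint_self] at this
    exact (this ▸ hmem i : f i ∈ (⊥ : Set (Cs Y)))
  rw [← mk_range_eq V hinj]
  refine le_cellularity ⟨?_, ?_⟩
  · rintro _ ⟨i, rfl⟩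
    exact ⟨isOpen_interior, _, hmem i⟩
  · rintro _ ⟨i, rfl⟩ _ ⟨j, rfl⟩ hne
    exact hdisj i j fun h => hne (h ▸ rfl)

/-- The values |f| along a suitable sequence are more than 1 apart, so the distance from |f| to the
values indexed by S separates S from every other subset of ℕ. -/
theorem continuum_le_cellularity_Cs {Y : Type u} [TopologicalSpace Y] (hY : ¬ Pseudocompact Y) :
    𝔠 ≤ cellularity (Cs Y) := by
  unfold Pseudocompact at hY
  push Not at hY
  obtain ⟨f, hf⟩ := hY
  choose p hp using hf
  let d : ℕ → Y := fun n => Nat.rec (p 0) (fun _ y => p (|f y| + 1)) n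
  have hd : ∀ n, |f (d n)| + 1 < |f (d (n + 1))| := fun n => hp _
  have hmono : ∀ m k, |f (d m)| + 1 < |f (d (m + 1 + k))| := by
    intro m k
    induction k with
    | zero => exact hd m
    | succ k ih => have := hd (m + 1 + k); rw [← add_assoc]; linarith
  have hsep : ∀ m n, m ≠ n → 1 < |(|f (d m)| - |f (d n)|)| := by
    intro m n hmn
    rcases lt_or_gt_of_ne hmn with h | h
    · obtain ⟨k, rfl⟩ := Nat.exists_eq_add_of_le (Nat.succ_le_of_lt h)
      have := hmono m k
      rw [lt_abs]; right; linarith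
    · obtain ⟨k, rfl⟩ := Nat.exists_eq_add_of_le (Nat.succ_le_of_lt h)
      have := hmono n k
      rw [lt_abs]; left; linarith
  let c : ℕ → ℝ := fun n => |f (d n)|
  have hmin : ∀ S : Set ℕ, ∃ g : C(Y, ℝ), (∀ n ∈ S, g (d n) = 0) ∧ ∀ n ∉ S, 1 ≤ g (d n) := by
    intro S
    rcases S.eq_empty_or_nonempty with rfl | hS
    · exact ⟨ContinuousMap.const _ 1, by simp⟩
    refine ⟨⟨fun y => Metric.infDist |f y| (c '' S),
      (Metric.continuous_infDist_pt _).comp f.continuous.abs⟩, fun n hn => ?_, fun n hn => ?_⟩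
    · exact Metric.infDist_zero_of_mem (mem_image_of_mem c hn)
    · refine (Metric.le_infDist (hS.image c)).2 ?_
      rintro _ ⟨m, hm, rfl⟩
      exact (hsep n m fun h => hn (h ▸ hm)).le
  choose g hg0 hg1 using hmin
  have key := mk_le_cellularity_Cs (ι := ULift.{u} (Set ℕ)) (fun S => g S.down)
    (fun _ => range d) (fun _ => countable_range d) ?_
  · rwa [mk_uLift, mk_set, mk_nat, two_power_aleph0, lift_continuum] at key
  · rintro ⟨S⟩ ⟨T⟩ hne
    have hne' : S ≠ T := fun h => hne (h ▸ rfl)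
    obtain ⟨n, hn⟩ : ∃ n, ¬ (n ∈ S ↔ n ∈ T) := by
      by_contra! h
      exact hne' (Set.ext h)
    refine ⟨d n, ⟨mem_range_self n, mem_range_self n⟩, ?_⟩
    by_cases hS : n ∈ S
    · have hT : n ∉ T := fun h => hn ⟨fun _ => h, fun _ => hS⟩
      have := hg1 T n hT
      change 1 ≤ |g S (d n) - g T (d n)|
      rw [hg0 S n hS, _root_.zero_sub, abs_neg]
      exact this.trans (le_abs_self _)
    · have hT : n ∈ T := by
        by_contra h
        exact hn ⟨fun h' => absurd h' hS, fun h' => absurd h' h⟩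
      have := hg1 S n hS
      change 1 ≤ |g S (d n) - g T (d n)|
      rw [hg0 T n hT, _root_.sub_zero]
      exact this.trans (le_abs_self _)

/-- Two functions that are close on `A ∩ B` have a common approximation on `A` and `B`. -/
theorem exists_approx_of_closed {Y : Type*} [TopologicalSpace Y] [NormalSpace Y] {A B : Set Y}
    (hA : IsClosed A) (hB : IsClosed B) (f g : C(Y, ℝ)) {ε δ : ℝ} (hδ : 0 < δ) (hδε : δ < ε)
    (hfg : ∀ x ∈ A ∩ B, |f x - g x| < δ) :
    ∃ h : C(Y, ℝ), (∀ x ∈ A, |h x - f x| < ε) ∧ ∀ x ∈ B, |h x - g x| < ε := by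
  have hC : IsClosed {x | δ ≤ |f x - g x|} := isClosed_le continuous_const (by fun_prop)
  obtain ⟨φ, h0, h1, h01⟩ := exists_continuous_zero_one_of_isClosed (hA.inter hC) (hB.inter hC)
    (Set.disjoint_left.2 fun x hx hx' => (hfg x ⟨hx.1, hx'.1⟩).not_ge hx.2)
  refine ⟨f + φ * (g - f), fun x hx => ?_, fun x hx => ?_⟩
  · have e : (f + φ * (g - f)) x - f x = φ x * (g x - f x) := by simp
    rw [e, abs_mul, abs_of_nonneg (h01 x).1, abs_sub_comm]
    by_cases h : δ ≤ |f x - g x|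
    · rw [h0 ⟨hx, h⟩]; simp; linarith
    · have := mul_le_mul_of_nonneg_right (h01 x).2 (abs_nonneg (f x - g x))
      linarith
  · have e : (f + φ * (g - f)) x - g x = (1 - φ x) * (f x - g x) := by simp; ring
    rw [e, abs_mul, abs_of_nonneg (sub_nonneg.2 (h01 x).2)]
    by_cases h : δ ≤ |f x - g x|
    · rw [h1 ⟨hx, h⟩]; simp; linarith
    · have := mul_le_mul_of_nonneg_right (sub_le_self 1 (h01 x).1) (abs_nonneg (f x - g x))
      linarith

/-- Sending a closure point to the next element of A is injective, since A meets (p, q] for closure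
points p < q. At most one closure point has no next element. -/
theorem Ordinal.countable_closure {A : Set Ordinal.{u}} (hA : A.Countable) :
    (closure A).Countable := by
  let next : Ordinal.{u} → Ordinal.{u} := fun p => sInf {a ∈ A | p < a}
  have hlt : ∀ p q, q ∈ closure A → p < q → ∃ a ∈ A, p < a ∧ a ≤ q := by
    intro p q hq hpq
    obtain ⟨a, ha, haA⟩ := mem_closure_iff.1 hq (Ioo p (Order.succ q)) isOpen_Ioo
      ⟨hpq, Order.lt_succ q⟩
    exact ⟨a, haA, ha.1, Order.lt_succ_iff.1 ha.2⟩
  have hsub : closure A ⊆ {p ∈ closure A | ∃ a ∈ A, p < a} ∪ {p ∈ closure A | ∀ a ∈ A, a ≤ p} := by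
    intro p hp
    by_cases h : ∃ a ∈ A, p < a
    · exact Or.inl ⟨hp, h⟩
    · push Not at h
      exact Or.inr ⟨hp, h⟩
  refine (Countable.union ?_ ?_).mono hsub
  · have hmem : ∀ p ∈ {p ∈ closure A | ∃ a ∈ A, p < a}, next p ∈ {a ∈ A | p < a} :=
      fun p hp => csInf_mem hp.2
    refine MapsTo.countable_of_injOn (f := next) (fun p hp => (hmem p hp).1) ?_ hA
    have key : ∀ p ∈ {p ∈ closure A | ∃ a ∈ A, p < a}, ∀ q ∈ {p ∈ closure A | ∃ a ∈ A, p < a},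
        p < q → next p ≠ next q := by
      intro p hp q hq hpq
      obtain ⟨a, haA, hpa, haq⟩ := hlt p q hq.1 hpq
      have h1 : next p ≤ a := csInf_le' ⟨haA, hpa⟩
      exact (h1.trans_lt (haq.trans_lt (hmem q hq).2)).ne
    intro p hp q hq h
    by_contra hne
    rcases lt_or_gt_of_ne hne with h' | h'
    · exact key p hp q hq h' h
    · exact key q hq p hp h' h.symm
  · refine Set.Subsingleton.countable fun p hp q hq => ?_
    by_contra hne
    rcases lt_or_gt_of_ne hne with h' | h'
    · obtain ⟨a, haA, hpa, -⟩ := hlt p q hq.1 h'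
      exact (hp.2 a haA).not_gt hpa
    · obtain ⟨a, haA, hpa, -⟩ := hlt q p hp.1 h'
      exact (hq.2 a haA).not_gt hpa

theorem Ordinal.countable_closure_subtype {X : Set Ordinal.{u}} {A : Set X} (hA : A.Countable) :
    (closure A).Countable := by
  have h := countable_closure (hA.image Subtype.val)
  rw [Topology.IsInducing.subtypeVal.closure_eq_preimage_closure_image]
  exact h.preimage Subtype.val_injective

/-- Uncountably many x in X have countable initial segments. The indicators of two such segments
differ at the successor, within X, of the smaller endpoint. -/
theorem aleph_one_le_cellularity_Cs {X : Set Ordinal.{u}} (hX : ¬ X.Countable) :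
    ℵ₁ ≤ cellularity (Cs X) := by
  let Y : Set Ordinal.{u} := {x ∈ X | (X ∩ Iic x).Countable}
  have hY : ¬ Y.Countable := by
    by_contra hY
    obtain ⟨x, hx, hmin⟩ : ∃ x ∈ X \ Y, ∀ y ∈ X \ Y, x ≤ y := by
      have hne : (X \ Y).Nonempty := by
        rw [Set.nonempty_iff_ne_empty]
        intro h
        exact hX (hY.mono (Set.sdiff_eq_empty.1 h))
      exact ⟨sInf (X \ Y), csInf_mem hne, fun y hy => csInf_le' hy⟩
    refine hx.2 ⟨hx.1, (hY.union (countable_singleton x)).mono ?_⟩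
    rintro z ⟨hz, hzx⟩
    rcases (show z ≤ x from hzx).lt_or_eq with h | h
    · by_contra h'
      exact (hmin z ⟨hz, fun hz' => h' (Or.inl hz')⟩).not_gt h
    · exact Or.inr h
  let Z : Set Ordinal.{u} := {x ∈ Y | ∃ y ∈ X, x < y}
  have hZ : ¬ Z.Countable := by
    intro hZ
    refine hY ((hZ.union (s := Z) (t := Y \ Z) (Set.Subsingleton.countable ?_)).mono ?_)
    · intro x hx y hy
      by_contra hne
      rcases lt_or_gt_of_ne hne with h | h
      · exact hx.2 ⟨hx.1, y, hy.1.1, h⟩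
      · exact hy.2 ⟨hy.1, x, hx.1.1, h⟩
    · exact fun x hx => by by_cases h : x ∈ Z <;> simp [h, hx]
  let nx : Ordinal.{u} → Ordinal.{u} := fun x => sInf {y ∈ X | x < y}
  have hs : ∀ x ∈ Z, nx x ∈ X ∧ x < nx x := fun x hx => csInf_mem (s := {y ∈ X | x < y}) hx.2
  have hs' : ∀ x, ∀ y ∈ X, x < y → nx x ≤ y := fun x y hy h => csInf_le' ⟨hy, h⟩
  have hcl : ∀ x, IsClopen {y : X | y.1 ≤ x} := fun x =>
    ⟨isClosed_Iic.preimage continuous_subtype_val, by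
      rw [show {y : X | y.1 ≤ x} = Subtype.val ⁻¹' Iio (Order.succ x) from
        Set.ext fun y => (Order.lt_succ_iff (a := y.1)).symm]
      exact isOpen_Iio.preimage continuous_subtype_val⟩
  have hcont : ∀ x, Continuous ({y : X | y.1 ≤ x}.indicator fun _ => (1 : ℝ)) := fun x =>
    continuous_const.indicator (by simp [(hcl x).frontier_eq])
  refine (aleph_one_le_iff.2 ?_).trans (mk_le_cellularity_Cs (Y := X) (ι := Z)
    (fun x => ⟨{y : X | y.1 ≤ x.1}.indicator fun _ => (1 : ℝ), hcont x.1⟩) (fun x => {y : X | y.1 ≤ nx x.1}) ?_ ?_)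
  · rw [← not_le]
    exact fun h => hZ (le_aleph0_iff_set_countable.1 h)
  · intro x
    have : (X ∩ Iic (nx x.1)).Countable := by
      refine (x.2.1.2.union (countable_singleton (nx x.1))).mono ?_
      rintro z ⟨hz, hzs⟩
      rcases le_or_gt z x.1 with h | h
      · exact Or.inl ⟨hz, h⟩
      · exact Or.inr (le_antisymm hzs (hs' _ _ hz h))
    exact (this.preimage Subtype.val_injective).mono fun y hy => (⟨y.2, hy⟩ : y.1 ∈ X ∩ Iic _)
  · have key : ∀ x y : Z, x.1 < y.1 → ∃ z : X, z.1 ≤ nx x.1 ∧ z.1 ≤ nx y.1 ∧ ¬ z.1 ≤ x.1 ∧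
        z.1 ≤ y.1 := by
      intro x y hxy
      have h1 := hs' x.1 y.1 y.2.1.1 hxy
      exact ⟨⟨nx x.1, (hs _ x.2).1⟩, le_rfl, h1.trans (hs _ y.2).2.le, (hs _ x.2).2.not_ge, h1⟩
    intro x y hne
    rcases lt_or_gt_of_ne hne with h | h
    · obtain ⟨z, h1, h2, h3, h4⟩ := key x y h
      exact ⟨z, ⟨h1, h2⟩, by simp [Set.indicator, h3, h4]⟩
    · obtain ⟨z, h1, h2, h3, h4⟩ := key y x h
      exact ⟨z, ⟨h2, h1⟩, by simp [Set.indicator, h3, h4]⟩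

/-! ### Approximation by step functions -/

theorem Pseudocompact.iSup_mem {X : Set Ordinal.{u}} (hX : Pseudocompact X) {v : ℕ → Ordinal.{u}}
    (hv : StrictMono v) (hvX : ∀ n, v n ∈ X) : ⨆ n, v n ∈ X := by
  by_contra hs
  have hle : ∀ n, v n ≤ ⨆ n, v n := Ordinal.le_iSup v
  -- Without the supremum in X this function is locally constant and unbounded; past the supremum it
  -- is `sInf ∅ = 0`.
  let F : X → ℝ := fun x => ((sInf {n | x.1 ≤ v n} : ℕ) : ℝ)
  have hF : Continuous F := by
    refine IsLocallyConstant.continuous (IsLocallyConstant.iff_eventually_eq F |>.2 fun x => ?_)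
    have hval : Tendsto (Subtype.val : X → Ordinal) (𝓝 x) (𝓝 x.1) := continuousAt_subtype_val
    rcases lt_or_ge x.1 (⨆ n, v n) with hx | hx
    · obtain ⟨m, hm⟩ := Ordinal.lt_iSup_iff.1 hx
      have hmem : x.1 ≤ v (sInf {n | x.1 ≤ v n}) := Nat.sInf_mem (s := {n | x.1 ≤ v n}) ⟨m, hm.le⟩
      set N := sInf {n | x.1 ≤ v n} with hN
      have h1 : ∀ᶠ y : X in 𝓝 x, y.1 ≤ v N := by
        filter_upwards [hval.eventually (Iio_mem_nhds (Order.lt_succ_iff.2 hmem))] with y hy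
        exact Order.lt_succ_iff.1 hy
      have h2 : ∀ᶠ y : X in 𝓝 x, ∀ k < N, v k < y.1 := by
        refine (eventually_all_finite (Set.finite_Iio N)).2 fun k hk => ?_
        exact hval.eventually (Ioi_mem_nhds (not_le.1 (Nat.notMem_of_lt_sInf hk)))
      filter_upwards [h1, h2] with y hy1 hy2
      have : sInf {n | y.1 ≤ v n} = N := by
        refine le_antisymm (Nat.sInf_le hy1) (not_lt.1 fun h => ?_)
        exact (hy2 _ h).not_ge (Nat.sInf_mem (s := {n | y.1 ≤ v n}) ⟨N, hy1⟩)
      simp only [F, this, hN]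
    · have hx' : (⨆ n, v n) < x.1 := lt_of_le_of_ne hx fun h => hs (h ▸ x.2)
      have hemp : ∀ y : X, (⨆ n, v n) < y.1 → F y = 0 := by
        intro y hy
        have : {n | y.1 ≤ v n} = ∅ :=
          Set.eq_empty_of_forall_notMem fun n hn => (hy.trans_le hn).not_ge (hle n)
        simp [F, this]
      filter_upwards [hval.eventually (Ioi_mem_nhds hx')] with y hy
      rw [hemp y hy, hemp x hx']
  obtain ⟨M, hM⟩ := hX ⟨F, hF⟩
  obtain ⟨n, hn⟩ := exists_nat_gt M
  have h := hM ⟨v n, hvX n⟩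
  have hFn : F ⟨v n, hvX n⟩ = n := by
    have : sInf {k | v n ≤ v k} = n := by
      simp only [hv.le_iff_le]
      exact (isLeast_Ici (a := n)).csInf_eq
    simp [F, this]
  change |F _| ≤ M at h
  rw [hFn, Nat.abs_cast] at h
  linarith

/-- The step function with value `q` before `a`, for the first entry `(a, q)` of the list that
applies. -/
noncomputable def stepFun : List (Ordinal.{u} × ℚ) → Ordinal.{u} → ℝ
  | [], _ => 0
  | p :: l, x => if x < p.1 then (p.2 : ℝ) else stepFun l x

/-- Take b least such that f oscillates by ε/2 on [a, b]. One rational value serves [a, b), so an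
approximation from b on would extend to a. -/
theorem Pseudocompact.exists_lt_of_not_osc {γ : Ordinal.{u}} {X : Set Ordinal.{u}}
    (hXγ : X ⊆ Iic γ) (f : X → ℝ) {ε : ℝ} (hε : 0 < ε) {a : Ordinal.{u}}
    (ha : ¬ ∃ l : List (Ordinal.{u} × ℚ), (∀ p ∈ l, p.1 ≤ Order.succ γ) ∧
      ∀ x : X, a ≤ x.1 → |f x - stepFun l x| < ε) :
    ∃ b, (¬ ∃ l : List (Ordinal.{u} × ℚ), (∀ p ∈ l, p.1 ≤ Order.succ γ) ∧
      ∀ x : X, b ≤ x.1 → |f x - stepFun l x| < ε) ∧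
      ∃ x y : X, a ≤ x.1 ∧ x < y ∧ y.1 ≤ b ∧ ε / 2 ≤ |f x - f y| := by
  let S : Set Ordinal.{u} := {b | ∃ x y : X, a ≤ x.1 ∧ x < y ∧ y.1 ≤ b ∧ ε / 2 ≤ |f x - f y|}
  have hext : ∀ b ≤ Order.succ γ, (∀ x y : X, a ≤ x.1 → x < y → y.1 < b → |f x - f y| < ε / 2) →
      ¬ ∃ l : List (Ordinal.{u} × ℚ), (∀ p ∈ l, p.1 ≤ Order.succ γ) ∧
      ∀ x : X, b ≤ x.1 → |f x - stepFun l x| < ε := by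
    rintro b hb hosc ⟨l, hl, hfl⟩
    obtain ⟨q, hq⟩ : ∃ q : ℚ, ∀ x : X, a ≤ x.1 → x.1 < b → |f x - q| < ε := by
      by_cases hne : ∃ x : X, a ≤ x.1 ∧ x.1 < b
      · obtain ⟨x, hax, hxb⟩ := hne
        obtain ⟨q, hq1, hq2⟩ := exists_rat_btwn (show f x < f x + ε / 2 by linarith)
        refine ⟨q, fun y hay hyb => ?_⟩
        have hxy : |f x - f y| < ε / 2 := by
          rcases lt_trichotomy x y with h | h | h
          · exact hosc x y hax h hyb
          · rw [h, _root_.sub_self, abs_zero]; linarith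
          · rw [abs_sub_comm]; exact hosc y x hay h hxb
        rw [abs_lt] at hxy ⊢
        constructor <;> linarith
      · exact ⟨0, fun x h1 h2 => absurd ⟨x, h1, h2⟩ hne⟩
    refine ha ⟨(b, q) :: l, ?_, fun x hx => ?_⟩
    · rintro p hp
      rcases List.mem_cons.1 hp with rfl | hp
      exacts [hb, hl p hp]
    · by_cases h : x.1 < b
      · simpa [stepFun, h] using hq x hx h
      · simpa [stepFun, h] using hfl x (not_lt.1 h)
  have hγ : γ ∈ S := by
    by_contra hS
    refine hext (Order.succ γ) le_rfl (fun x y h1 h2 h3 => ?_) ⟨[], by simp, fun x hx => ?_⟩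
    · by_contra h
      exact hS ⟨x, y, h1, h2, Order.lt_succ_iff.1 h3, not_lt.1 h⟩
    · exact absurd (hXγ x.2) (Order.succ_le_iff.1 hx).not_ge
  refine ⟨sInf S, hext _ ((csInf_le' hγ).trans (Order.le_succ γ)) fun x y h1 h2 h3 => ?_,
    csInf_mem ⟨γ, hγ⟩⟩
  by_contra h
  exact (csInf_le' (show y.1 ∈ S from ⟨x, y, h1, h2, le_rfl, not_lt.1 h⟩)).not_gt h3

/-- Continuous functions on a pseudocompact set of ordinals are approximated by step functions. -/
theorem Pseudocompact.exists_stepFun {γ : Ordinal.{u}} {X : Set Ordinal.{u}}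
    (hXγ : X ⊆ Iic γ) (hX : Pseudocompact X) (f : C(X, ℝ)) {ε : ℝ} (hε : 0 < ε) :
    ∃ l : List (Ordinal.{u} × ℚ), (∀ p ∈ l, p.1 ≤ Order.succ γ) ∧
      ∀ x : X, |f x - stepFun l x| < ε := by
  by_contra hcon
  let P : Ordinal.{u} → Prop := fun a => ∃ l : List (Ordinal.{u} × ℚ),
    (∀ p ∈ l, p.1 ≤ Order.succ γ) ∧ ∀ x : X, a ≤ x.1 → |f x - stepFun l x| < ε
  have h0 : ¬ P 0 := fun ⟨l, h1, h2⟩ => hcon ⟨l, h1, fun x => h2 x zero_le⟩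
  have hstep : ∀ a : {a // ¬ P a}, ∃ b : {a // ¬ P a},
      ∃ x y : X, a.1 ≤ x.1 ∧ x < y ∧ y.1 ≤ b.1 ∧ ε / 2 ≤ |f x - f y| := fun a => by
    obtain ⟨b, hb, h⟩ := exists_lt_of_not_osc hXγ f hε a.2
    exact ⟨⟨b, hb⟩, h⟩
  choose next x y hx hxy hy hf using hstep
  -- Iteration gives interleaved sequences with a common supremum in X and jumps at least ε/2,
  -- contradicting continuity there.
  let a : ℕ → {a // ¬ P a} := fun n => Nat.rec ⟨0, h0⟩ (fun _ b => next b) n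
  have hyx : ∀ n, (y (a n)).1 ≤ (x (a (n + 1))).1 := fun n => (hy (a n)).trans (hx (a (n + 1)))
  have hmono : StrictMono fun n => (y (a n)).1 :=
    strictMono_nat_of_lt_succ fun n => (hyx n).trans_lt (hxy (a (n + 1)))
  have hs := hX.iSup_mem hmono fun n => (y (a n)).2
  let s : X := ⟨_, hs⟩
  have hty : Tendsto (fun n => (y (a n)).1) atTop (𝓝 s.1) :=
    tendsto_atTop_ciSup hmono.monotone Ordinal.bddAbove_of_small
  have htx : Tendsto (fun n => (x (a (n + 1))).1) atTop (𝓝 s.1) :=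
    tendsto_of_tendsto_of_tendsto_of_le_of_le hty ((tendsto_add_atTop_iff_nat 1).2 hty) hyx
      fun n => (hxy (a (n + 1))).le
  have hty' : Tendsto (fun n => y (a (n + 1))) atTop (𝓝 s) :=
    tendsto_subtype_rng.2 ((tendsto_add_atTop_iff_nat 1).2 hty)
  have htx' : Tendsto (fun n => x (a (n + 1))) atTop (𝓝 s) := tendsto_subtype_rng.2 htx
  have hlim : Tendsto (fun n => |f (x (a (n + 1))) - f (y (a (n + 1)))|) atTop
      (𝓝 |f s - f s|) :=
    (((f.continuous.tendsto s).comp htx').sub ((f.continuous.tendsto s).comp hty')).abs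
  have := ge_of_tendsto' hlim fun n => hf (a (n + 1))
  rw [_root_.sub_self, abs_zero] at this
  linarith

/-! ### Reflection in a tower of countable sets -/

/-- If `l'` has the same values as `l` and its points are squeezed between the same bounds, then
the step functions agree wherever the bounds decide the position. -/
theorem stepFun_eq_of_forall₂ {x : Ordinal.{u}} {l l' : List (Ordinal.{u} × ℚ)}
    {p : List (Ordinal.{u} × Ordinal.{u} × ℚ)}
    (h : List.Forall₂ (fun p a => p.1 ≤ a.1 ∧ a.1 ≤ p.2.1 ∧ a.2 = p.2.2) p l)
    (h' : List.Forall₂ (fun p a => p.1 ≤ a.1 ∧ a.1 ≤ p.2.1 ∧ a.2 = p.2.2) p l')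
    (hx : ∀ c ∈ p, x < c.1 ∨ c.2.1 ≤ x) : stepFun l x = stepFun l' x := by
  induction h generalizing l' with
  | nil => cases h'; rfl
  | cons h1 _ ih =>
    cases h' with
    | cons h2 h3 =>
      rw [stepFun, stepFun, ih h3 fun c hc => hx c (List.mem_cons_of_mem _ hc), h1.2.2, h2.2.2]
      rcases hx _ List.mem_cons_self with h | h
      · rw [if_pos (h.trans_le h1.1), if_pos (h.trans_le h2.1)]
      · rw [if_neg (h1.2.1.trans h).not_gt, if_neg (h2.2.1.trans h).not_gt]

/-- An increasing `ω₁`-chain of countable sets, closed under a given operation. -/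
theorem exists_countable_tower {α : Type*} (G : Set α → Set α)
    (hG : ∀ S : Set α, S.Countable → (G S).Countable) :
    ∃ M : Iio (ω₁ : Ordinal.{u}) → Set α, (∀ i, (M i).Countable) ∧
      (∀ C : Set α, C.Countable → C ⊆ ⋃ i, M i → ∃ i, C ⊆ M i) ∧
      ∀ i, G (M i) ⊆ ⋃ j, M j := by
  let N : Ordinal.{u} → Set α := WellFoundedLT.fix fun i N => ⋃ j : Iio i, (N j j.2 ∪ G (N j j.2))
  have hN : ∀ i, N i = ⋃ j : Iio i, (N j ∪ G (N j)) := fun i => WellFoundedLT.fix_eq _ i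
  have hmono : ∀ i j, j < i → N j ∪ G (N j) ⊆ N i := fun i j hj => by
    conv_rhs => rw [hN i]
    exact subset_iUnion (fun j : Iio i => N j ∪ G (N j)) ⟨j, hj⟩
  have hcount : ∀ i, i < ω₁ → (N i).Countable := by
    intro i
    induction i using WellFoundedLT.induction with
    | ind i ih =>
      intro hi
      rw [hN i]
      have : Countable (Iio i) := by
        rw [← mk_le_aleph0_iff, Cardinal.mk_Iio_ordinal, lift_le_aleph0, ← lt_aleph_one_iff]
        exact lt_ord.1 (by rwa [ord_aleph])
      refine countable_iUnion fun j => ?_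
      have := ih j j.2 (lt_trans j.2 hi)
      exact this.union (hG _ this)
  refine ⟨fun i => N i, fun i => hcount i i.2, fun C hC hCM => ?_, fun i => ?_⟩
  · have : Countable C := hC
    choose r hr using fun c : C => mem_iUnion.1 (hCM c.2)
    have hlt : ⨆ c : C, Order.succ (r c).1 < ω₁ := by
      refine Ordinal.iSup_lt_omega_one fun c => ?_
      exact (isSuccLimit_omega 1).succ_lt (r c).2
    refine ⟨⟨_, hlt⟩, fun c hc => ?_⟩
    have hle : Order.succ (r ⟨c, hc⟩).1 ≤ ⨆ c : C, Order.succ (r c).1 :=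
      Ordinal.le_iSup (fun c : C => Order.succ (r c).1) ⟨c, hc⟩
    exact hmono _ _ (Order.succ_le_iff.1 hle) (Or.inl (hr ⟨c, hc⟩))
  · have hlim : Order.succ i.1 < ω₁ := (isSuccLimit_omega 1).succ_lt i.2
    exact fun x hx => mem_iUnion.2 ⟨⟨_, hlim⟩, hmono _ _ (Order.lt_succ _) (Or.inr hx)⟩

/-- An elementary-submodel argument: an index δ outside the tower is copied by an index `Φ _` chosen
from a pattern of bounds and values inside it. Points common to both supports never fall where the
bounds leave the order undecided. -/
theorem exists_ne_stepFun_eq {ι : Type (u + 1)} (hι : ℵ₁ < #ι) {γ : Ordinal.{u}}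
    (l : ι → List (Ordinal.{u} × ℚ)) (hl : ∀ i, ∀ p ∈ l i, p.1 ≤ Order.succ γ)
    (A : ι → Set Ordinal.{u}) (hA : ∀ i, (A i).Countable) (k : ι → ℕ) :
    ∃ i j, i ≠ j ∧ k i = k j ∧ ∀ x ∈ A i ∩ A j, stepFun (l i) x = stepFun (l j) x := by
  have hne : Nonempty ι := mk_ne_zero_iff.1 (ne_bot_of_gt hι)
  let R : Ordinal.{u} × Ordinal.{u} × ℚ → Ordinal.{u} × ℚ → Prop :=
    fun p a => p.1 ≤ a.1 ∧ a.1 ≤ p.2.1 ∧ a.2 = p.2.2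
  let Φ : ℕ × List (Ordinal.{u} × Ordinal.{u} × ℚ) → ι := fun p =>
    Classical.epsilon fun i => k i = p.1 ∧ List.Forall₂ R p.2 (l i)
  have hΦ : ∀ p i, k i = p.1 → List.Forall₂ R p.2 (l i) →
      k (Φ p) = p.1 ∧ List.Forall₂ R p.2 (l (Φ p)) := fun p i h h' =>
    Classical.epsilon_spec (p := fun i => k i = p.1 ∧ List.Forall₂ R p.2 (l i)) ⟨i, h, h'⟩
  let val : ∀ S : Set Ordinal.{u}, S × S × ℚ → Ordinal.{u} × Ordinal.{u} × ℚ :=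
    fun S t => (t.1.1, t.2.1.1, t.2.2)
  let lb : Set Ordinal.{u} → Ordinal.{u} → Ordinal.{u} :=
    fun S c => sInf {o | ∀ m ∈ S, m < c → m < o}
  let G : Set Ordinal.{u} → Set Ordinal.{u} := fun S =>
    insert (Order.succ γ) (lb S '' S ∪ ⋃ p : ℕ × List (S × S × ℚ), A (Φ (p.1, p.2.map (val S))))
  obtain ⟨M, hMc, hMd, hMG⟩ := exists_countable_tower.{u} G fun S hS => by
    have : Countable S := hS
    exact ((hS.image _).union (countable_iUnion fun p => hA _)).insert _
  -- The tower contains only `ℵ₁` patterns.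
  obtain ⟨δ, hδ⟩ : ∃ δ, δ ∉ range fun q : Σ i, ℕ × List (M i × M i × ℚ) =>
      Φ (q.2.1, q.2.2.map (val (M q.1))) := by
    by_contra! hall
    have hle : #ι ≤ #(Σ i, ℕ × List (M i × M i × ℚ)) := mk_le_of_surjective hall
    refine hι.not_ge (hle.trans ?_)
    rw [mk_sigma]
    have hc : ∀ i, #(ℕ × List (M i × M i × ℚ)) ≤ ℵ₀ := fun i => by
      have : Countable (M i) := hMc i
      exact mk_le_aleph0
    refine (sum_le_sum _ (fun _ => ℵ₀) hc).trans ?_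
    rw [sum_const', Cardinal.mk_Iio_ordinal, card_omega, lift_aleph, Ordinal.lift_one]
    exact (mul_le_max_of_aleph0_le_left (aleph0_le_aleph 1)).trans
      (max_le le_rfl (aleph0_le_aleph 1))
  set U := ⋃ i, M i with hU
  have hγ : Order.succ γ ∈ U := hMG ⟨0, omega_pos 1⟩ (mem_insert _ _)
  let up : Ordinal.{u} → Ordinal.{u} := fun a => sInf {m ∈ U | a ≤ m}
  have hup : ∀ p ∈ l δ, up p.1 ∈ U ∧ p.1 ≤ up p.1 := fun p hp =>
    csInf_mem (s := {m ∈ U | p.1 ≤ m}) ⟨_, hγ, hl δ p hp⟩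
  have hlt : ∀ a, ∀ m ∈ U, m < up a → m < a := fun a m hm h => by
    by_contra h'
    exact (csInf_le' (s := {m ∈ U | a ≤ m}) ⟨hm, not_lt.1 h'⟩).not_gt h
  have hfin : ∀ φ : Ordinal.{u} × ℚ → Ordinal.{u}, (φ '' {p | p ∈ l δ}).Countable := fun φ =>
    ((l δ).finite_toSet.image φ).countable
  obtain ⟨i, hi⟩ := hMd ((A δ ∩ U) ∪ (fun p => up p.1) '' {p | p ∈ l δ})
    (((hA δ).mono inter_subset_left).union (hfin _)) (by
      rintro x (hx | ⟨p, hp, rfl⟩)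
      exacts [hx.2, (hup p hp).1])
  let lo : Ordinal.{u} → Ordinal.{u} := fun a => lb (M i) (up a)
  have hlo : ∀ p ∈ l δ, lo p.1 ∈ U := fun p hp =>
    hMG i (Or.inr (Or.inl (mem_image_of_mem _ (hi (Or.inr ⟨p, hp, rfl⟩)))))
  have hlo_le : ∀ a, lo a ≤ a := fun a =>
    csInf_le' fun m hm h => hlt a m (mem_iUnion_of_mem i hm) h
  have hlo_lt : ∀ a, ∀ m ∈ M i, m < up a → m < lo a :=
    fun a => csInf_mem (s := {o | ∀ m ∈ M i, m < up a → m < o}) ⟨up a, fun _ _ h => h⟩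
  obtain ⟨j, hj⟩ := hMd ((fun p => lo p.1) '' {p | p ∈ l δ} ∪ (fun p => up p.1) '' {p | p ∈ l δ})
    ((hfin _).union (hfin _)) (by
      rintro x (⟨p, hp, rfl⟩ | ⟨p, hp, rfl⟩)
      exacts [hlo p hp, (hup p hp).1])
  obtain ⟨L, hL⟩ : (l δ).map (fun p => (lo p.1, up p.1, p.2)) ∈ range (List.map (val (M j))) := by
    rw [range_list_map]
    intro t ht
    obtain ⟨p, hp, rfl⟩ := List.mem_map.1 ht
    exact ⟨(⟨_, hj (Or.inl ⟨p, hp, rfl⟩)⟩, ⟨_, hj (Or.inr ⟨p, hp, rfl⟩)⟩, p.2), rfl⟩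
  have hR : List.Forall₂ R (L.map (val (M j))) (l δ) := by
    rw [hL, List.forall₂_map_left_iff, List.forall₂_same]
    exact fun p hp => ⟨hlo_le _, (hup p hp).2, rfl⟩
  obtain ⟨hk, hR'⟩ := hΦ (k δ, L.map (val (M j))) δ rfl hR
  refine ⟨Φ (k δ, L.map (val (M j))), δ, fun h => hδ ⟨⟨j, k δ, L⟩, h⟩, hk, fun x hx => ?_⟩
  -- The copy's support lies in U, and `M i` contains the trace of `A δ` on U; no point of `M i`
  -- lies in [lo, up).
  have hxU : x ∈ U := hMG j (Or.inr (Or.inr (mem_iUnion.2 ⟨(k δ, L), hx.1⟩)))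
  have hxi : x ∈ M i := hi (Or.inl ⟨hx.2, hxU⟩)
  refine stepFun_eq_of_forall₂ hR' hR fun c hc => ?_
  rw [hL] at hc
  obtain ⟨p, hp, rfl⟩ := List.mem_map.1 hc
  rcases lt_or_ge x (up p.1) with h | h
  · exact Or.inl (hlo_lt _ x hxi h)
  · exact Or.inr h

/-! ### The upper bound and the conclusion -/

theorem Pseudocompact.cellularity_Cs_le {γ : Ordinal.{u}} {X : Set Ordinal.{u}}
    (hXγ : X ⊆ Iic γ) (hX : Pseudocompact X) : cellularity (Cs X) ≤ ℵ₁ := by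
  refine csInf_le' ⟨aleph0_le_aleph 1, fun 𝒰 h𝒰 => ?_⟩
  by_contra hlt
  rw [not_le] at hlt
  -- Two errors of a quarter radius keep the functions within half the radius where their step
  -- functions agree.
  have hex : ∀ V : 𝒰, ∃ (f : C(X, ℝ)) (A : Set X) (k : ℕ) (l : List (Ordinal.{u} × ℚ)),
      A.Countable ∧ Cs.near f A (1 / ((k : ℝ) + 1)) ⊆ V.1 ∧ (∀ p ∈ l, p.1 ≤ Order.succ γ) ∧
      ∀ x : X, |f x - stepFun l x| < 1 / ((k : ℝ) + 1) / 4 := by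
    intro V
    obtain ⟨hVo, f, hf⟩ := h𝒰.1 V.1 V.2
    obtain ⟨⟨A, ε⟩, ⟨hA, hε⟩, hAV⟩ := (Cs.hasBasis_nhds f).mem_iff.1 (hVo.mem_nhds hf)
    obtain ⟨k, hk⟩ := exists_nat_one_div_lt hε
    obtain ⟨l, hl, hfl⟩ := hX.exists_stepFun hXγ f
      (ε := 1 / ((k : ℝ) + 1) / 4) (by positivity)
    exact ⟨f, A, k, l, hA, fun g hg => hAV fun x hx => (hg x hx).trans hk, hl, hfl⟩
  choose f A k l hA hV hl hfl using hex
  obtain ⟨V, W, hne, hk, hag⟩ := exists_ne_stepFun_eq hlt l hl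
    (fun V => Subtype.val '' closure (A V))
    (fun V => (Ordinal.countable_closure_subtype (hA V)).image _) k
  have hpos : (0 : ℝ) < 1 / ((k W : ℝ) + 1) := by positivity
  have hVf := hfl V
  have hVV := hV V
  rw [hk] at hVf hVV
  obtain ⟨h, h1, h2⟩ := exists_approx_of_closed (isClosed_closure (s := A V))
    (isClosed_closure (s := A W)) (f V) (f W) (half_pos hpos) (half_lt_self hpos) fun x hx => by
      have e := hag x.1 ⟨mem_image_of_mem _ hx.1, mem_image_of_mem _ hx.2⟩
      have a1 := abs_lt.1 (hVf x)
      have a2 := abs_lt.1 (hfl W x)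
      rw [abs_lt]
      constructor <;> linarith
  have hd := h𝒰.2 V.2 W.2 fun e => hne (Subtype.ext e)
  have hhV : h ∈ V.1 := hVV fun x hx => h1 x (subset_closure hx)
  exact Set.disjoint_left.1 hd hhV (hV W fun x hx => h2 x (subset_closure hx))

theorem mainTheorem6 (hCH : Cardinal.continuum.{0} ≠ Cardinal.aleph.{0} 1)
    (γ : Ordinal.{u}) (X : Set Ordinal.{u}) (hXγ : X ⊆ Set.Iic γ) (hX : ¬ X.Countable) :
    Pseudocompact X ↔ cellularity (Cs X) = Cardinal.aleph 1 := by
  refine ⟨fun h => (h.cellularity_Cs_le hXγ).antisymm (aleph_one_le_cellularity_Cs hX),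
    fun h => ?_⟩
  by_contra hX'
  have hle : Cardinal.continuum ≤ Cardinal.aleph 1 := h ▸ continuum_le_cellularity_Cs hX'
  refine hCH (le_antisymm ?_ aleph_one_le_continuum)
  rwa [← lift_continuum.{u + 1, 0}, lift_le_aleph_one] at hle
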